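/- For positive integers $m,k$ let $\mathbf V^\circ_{m,k}$ denote the set of real $m\times k$ matrices $V$ with orthonormal columns ($V^TV=I_k$), each column of which sums to zero. There are absolute constants $c_1,c_2>0$ such that for all integers $k\ge 1$ and $m\ge 4k$ there is a finite set $\mathcal V\subset \mathbf V^\circ_{m,k}$ with the following three properties: 1. $\|VV^T-V'V'^T\|_F^2\ \ge\ c_1 k$ for all distinct $V,V'\in\mathcal V$, where $\|\cdot\|_F$ is the Frobenius norm; 2. $\log|\mathcal V|\ \ge\ c_2\, m k$; 3. $|(VV^T)_{ij}|\ \le\ 4k/m$ for every $V\in\mathcal V$ and all $1\le i,j\le m$. -/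

import Mathlib

open scoped Matrix

-- `‖A‖` for a matrix `A` denotes its Frobenius norm.
attribute [local instance] Matrix.frobeniusNormedAddCommGroup

/-- The real `m × k` matrices with orthonormal columns, each of which sums to zero. -/
def centeredStiefel (m k : ℕ) : Set (Matrix (Fin m) (Fin k) ℝ) :=
  {V | Vᵀ * V = 1 ∧ ∀ j, ∑ i, V i j = 0}

/-!
With `t = m / (2 * k)`, which is at least `2`, stack orthogonal `k × k` matrices `O₁, …, O_t` as
`V = (2t)^(-1/2) [O₁; -O₁; …; O_t; -O_t; 0]`. The opposite signs make every column sum to zero, and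
every row of `V` has squared length at most `1 / (2t) ≤ 4k / m`, so by Cauchy-Schwarz the entries of
`V Vᵀ` are small whatever the `Oᵢ` are. It remains to choose the `Oᵢ` so that the projections
`V Vᵀ` are far apart.

If at least one block is frozen to the identity, then `Vᵀ V'` is an average of identity matrices
and of the `Oᵢᵀ Oᵢ'`, and expanding its norm bounds `‖V Vᵀ - V' V'ᵀ‖² = 2k - 2 ‖Vᵀ V'‖²` below by a
multiple of `∑ ‖Oᵢ - Oᵢ'‖²` (`frobenius_norm_sq_blockFrame_ge`). About half of the blocks are
frozen, and the free ones range over a code whose alphabet is a set of `exp(c k²)` orthogonal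
matrices at mutual distance at least a multiple of `√k`.

The alphabet is built column by column: each column in the first half is chosen from a set of
`exp(c k)` separated unit vectors in the orthogonal complement of the previous columns, and those
unit vectors in turn come from a binary code. All three codes are instances of one
Gilbert-Varshamov bound, `exists_adaptive_code`, for words whose letters are realised in a metric
space in a way that may depend on the previous letters. The bound survives this dependence because,
for any target, at most one of several separated candidates is close to it.
-/

/-! ### A Gilbert-Varshamov bound for adaptive sequences -/

/-- A maximal set of pairwise non-close points is a covering, so if each ball has at most `B`
points then it has at least `card X / B` points. -/
theorem exists_separated_card_mul_ge {X : Type*} [Fintype X] (close : X → X → Prop)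
    (hrefl : ∀ x, close x x) (hsymm : ∀ x y, close x y → close y x) (B : ℝ)
    (hB : ∀ y, (({x | close x y} : Set X).ncard : ℝ) ≤ B) :
    ∃ C : Finset X, (∀ x ∈ C, ∀ y ∈ C, x ≠ y → ¬ close x y) ∧
      (Fintype.card X : ℝ) ≤ C.card * B := by
  classical
  obtain ⟨C, hC, hmax⟩ := Set.Finite.exists_maximal
    (Set.toFinite {C : Finset X | ∀ x ∈ C, ∀ y ∈ C, x ≠ y → ¬ close x y})
    ⟨∅, by simp⟩
  refine ⟨C, hC, ?_⟩
  have hcover : (Finset.univ : Finset X) ⊆ C.biUnion fun y => {x | close x y} := by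
    intro x _
    simp only [Finset.mem_biUnion, Finset.mem_filter, Finset.mem_univ, true_and]
    by_contra! hx
    have hins : insert x C ∈ {C : Finset X | ∀ x ∈ C, ∀ y ∈ C, x ≠ y → ¬ close x y} := by
      intro a ha b hb hab
      rcases Finset.mem_insert.1 ha with hax | ha <;> rcases Finset.mem_insert.1 hb with hbx | hb
      · exact absurd (hax.trans hbx.symm) hab
      · exact hax ▸ hx b hb
      · exact fun h => hx a ha (hsymm _ _ (hbx ▸ h))
      · exact hC a ha b hb hab
    have : x ∈ C := hmax hins (Finset.subset_insert x C) (Finset.mem_insert_self x C)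
    exact hx x this (hrefl x)
  calc (Fintype.card X : ℝ) ≤ ((C.biUnion fun y => {x | close x y}).card : ℝ) := by
        exact_mod_cast Finset.card_le_card hcover
    _ ≤ ∑ y ∈ C, (({x | close x y} : Finset X).card : ℝ) := by
        exact_mod_cast Finset.card_biUnion_le
    _ ≤ ∑ _y ∈ C, B := by
        refine Finset.sum_le_sum fun y _ => ?_
        have := hB y
        rwa [Set.ncard_eq_toFinset_card', Set.toFinset_ofPred] at this
    _ = C.card * B := by simp

/-- The sequence in `E` spelled by a word in the alphabet `α`, when `next n u a` is the element that
the letter `a` stands for after the sequence `u` of length `n`. The newest letter and the newest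
element come first, so words are read from right to left. -/
def adaptiveSeq {α E : Type*} (next : ∀ n, (Fin n → E) → α → E) :
    ∀ n, (Fin n → α) → Fin n → E
  | 0, _ => Fin.elim0
  | n + 1, x => Fin.cons (next n (adaptiveSeq next n (Fin.tail x)) (x 0))
      (adaptiveSeq next n (Fin.tail x))

theorem adaptiveSeq_const {α E : Type*} (f : α → E) (n : ℕ) (x : Fin n → α) :
    adaptiveSeq (fun _ _ => f) n x = fun i => f (x i) := by
  induction n with
  | zero => exact funext fun i => i.elim0
  | succ n ih =>
    refine funext fun i => ?_
    refine Fin.cases ?_ (fun i => ?_) i <;> simp [adaptiveSeq, ih, Fin.tail]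

open Classical in
/-- The Hamming-type distance of two sequences: the number of positions where they are at
distance at least `r`. -/
noncomputable def farCount {E : Type*} [PseudoMetricSpace E] (r : ℝ) {n : ℕ}
    (u v : Fin n → E) : ℕ :=
  Finset.card {i | r ≤ dist (u i) (v i)}

section
variable {α E : Type*} [Fintype α] [PseudoMetricSpace E]

theorem farCount_self {r : ℝ} (hr : 0 < r) {n : ℕ} (u : Fin n → E) : farCount r u u = 0 := by
  simp [farCount, hr]

theorem farCount_comm (r : ℝ) {n : ℕ} (u v : Fin n → E) : farCount r u v = farCount r v u := by
  simp [farCount, dist_comm]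

open Classical in
theorem farCount_cons (r : ℝ) {n : ℕ} (a : E) (u : Fin n → E) (v : Fin (n + 1) → E) :
    farCount r (Fin.cons a u : Fin (n + 1) → E) v =
      (if r ≤ dist a (v 0) then 1 else 0) + farCount r u (Fin.tail v) := by
  rw [farCount, farCount, Finset.card_filter, Finset.card_filter, Fin.sum_univ_succ]
  simp only [Fin.cons_zero, Fin.cons_succ, Fin.tail]
  congr!

/-- An exponential-moment form of the ball-size bound: at each position at most one letter leads
close to the target and contributes weight `1`, and every other letter contributes `z`. -/
theorem sum_pow_farCount_le (next : ∀ n, (Fin n → E) → α → E) {ε : ℝ}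
    (hsep : ∀ n u a b, a ≠ b → ε ≤ dist (next n u a) (next n u b)) {z : ℝ} (hz : 0 ≤ z) (n : ℕ)
    (v : Fin n → E) :
    ∑ x : Fin n → α, z ^ farCount (ε / 2) (adaptiveSeq next n x) v ≤
      (1 + Fintype.card α * z) ^ n := by
  classical
  induction n with
  | zero => simp [farCount]
  | succ n ih =>
    rw [← (Fin.consEquiv fun _ : Fin (n + 1) => α).sum_comp, Fintype.sum_prod_type_right, pow_succ]
    refine (Finset.sum_le_sum fun x _ => ?_).trans
      ((Finset.sum_mul _ _ _).symm.le.trans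
        (mul_le_mul_of_nonneg_right (ih (Fin.tail v)) (by positivity)))
    have hstep : ∀ a : α, z ^ farCount (ε / 2)
          (adaptiveSeq next (n + 1) (Fin.consEquiv (fun _ : Fin (n + 1) => α) (a, x))) v =
        z ^ farCount (ε / 2) (adaptiveSeq next n x) (Fin.tail v) *
          (if ε / 2 ≤ dist (next n (adaptiveSeq next n x) a) (v 0) then z else 1) := by
      intro a
      have : adaptiveSeq next (n + 1) (Fin.consEquiv (fun _ : Fin (n + 1) => α) (a, x)) =
          Fin.cons (next n (adaptiveSeq next n x) a) (adaptiveSeq next n x) := by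
        simp [adaptiveSeq, Fin.consEquiv]
      rw [this, farCount_cons, pow_add, mul_comm]
      split_ifs <;> simp
    rw [Finset.sum_congr rfl fun a _ => hstep a, ← Finset.mul_sum]
    refine mul_le_mul_of_nonneg_left ?_ (by positivity)
    -- by the triangle inequality at most one candidate is close to the target `v 0`
    have hone :
        Finset.card {a : α | ¬ ε / 2 ≤ dist (next n (adaptiveSeq next n x) a) (v 0)} ≤ 1 := by
      refine Finset.card_le_one.2 fun a ha b hb => ?_
      simp only [Finset.mem_filter, Finset.mem_univ, true_and, not_le] at ha hb
      by_contra hab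
      have h1 := hsep n (adaptiveSeq next n x) a b hab
      have h2 := dist_triangle_right (next n (adaptiveSeq next n x) a)
        (next n (adaptiveSeq next n x) b) (v 0)
      linarith
    rw [Finset.sum_ite, Finset.sum_const, Finset.sum_const, nsmul_eq_mul, nsmul_eq_mul, mul_one,
      add_comm]
    refine add_le_add (by exact_mod_cast hone) (mul_le_mul_of_nonneg_right ?_ hz)
    exact_mod_cast Finset.card_le_univ _

/-- The adaptive Gilbert-Varshamov bound: a quarter of all the entropy of words of length `n`
survives after requiring that the sequences differ substantially in an eighth of the positions. -/
theorem exists_adaptive_code (next : ∀ n, (Fin n → E) → α → E) {ε : ℝ} (hε : 0 < ε)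
    (hsep : ∀ n u a b, a ≠ b → ε ≤ dist (next n u a) (next n u b)) (hα : 2 ≤ Fintype.card α)
    (n : ℕ) :
    ∃ C : Finset (Fin n → α),
      (∀ x ∈ C, ∀ y ∈ C, x ≠ y →
        (n : ℝ) / 8 ≤ farCount (ε / 2) (adaptiveSeq next n x) (adaptiveSeq next n y)) ∧
      (n : ℝ) / 4 * Real.log (Fintype.card α) ≤ Real.log C.card := by
  set q : ℝ := (Fintype.card α : ℝ) with hq
  have hq2 : (2 : ℝ) ≤ q := by rw [hq]; exact_mod_cast hα
  have hq0 : 0 < q := by linarith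
  -- the weight `z = 1 / (4 q)` turns the exponential sum into a bound on the size of balls
  set B : ℝ := (4 * q) ^ ((n : ℝ) / 8) * (5 / 4) ^ n with hBdef
  have hBpos : 0 < B := by positivity
  obtain ⟨C, hC, hcard⟩ := exists_separated_card_mul_ge
    (fun x y : Fin n → α => (farCount (ε / 2) (adaptiveSeq next n x) (adaptiveSeq next n y) : ℝ)
      ≤ (n : ℝ) / 8)
    (fun x => by rw [farCount_self (by positivity), Nat.cast_zero]; positivity)
    (fun x y h => by rwa [farCount_comm]) B (fun y => by
      classical
      rw [Set.ncard_eq_toFinset_card', Set.toFinset_ofPred]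
      have hsum := sum_pow_farCount_le next hsep (z := (4 * q)⁻¹) (by positivity) n
        (adaptiveSeq next n y)
      have h54 : 1 + (Fintype.card α : ℝ) * (4 * q)⁻¹ = 5 / 4 := by
        rw [← hq]; field_simp; norm_num
      rw [h54] at hsum
      rw [hBdef, ← div_le_iff₀' (by positivity)]
      refine le_trans ?_ hsum
      refine le_trans ?_ (Finset.sum_le_sum_of_subset_of_nonneg (Finset.filter_subset
        (fun x : Fin n → α => (farCount (ε / 2) (adaptiveSeq next n x) (adaptiveSeq next n y) : ℝ)
          ≤ (n : ℝ) / 8) Finset.univ) fun _ _ _ => by positivity)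
      rw [div_eq_mul_inv, ← nsmul_eq_mul]
      refine Finset.card_nsmul_le_sum _ _ _ fun x hx => ?_
      rw [inv_pow, ← Real.rpow_natCast]
      exact inv_anti₀ (by positivity)
        (Real.rpow_le_rpow_of_exponent_le (by linarith) (Finset.mem_filter.1 hx).2))
  refine ⟨C, fun x hx y hy hxy => (not_le.1 (hC x hx y hy hxy)).le, ?_⟩
  rw [Fintype.card_fun, Fintype.card_fin, Nat.cast_pow, ← hq] at hcard
  have hCpos : (0 : ℝ) < C.card := by
    by_contra h
    have : (C.card : ℝ) * B ≤ 0 := mul_nonpos_of_nonpos_of_nonneg (not_lt.1 h) hBpos.le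
    have : 0 < q ^ n := by positivity
    linarith
  have hlog := Real.log_le_log (by positivity) hcard
  rw [Real.log_mul hCpos.ne' hBpos.ne', Real.log_pow, hBdef,
    Real.log_mul (by positivity) (by positivity), Real.log_rpow (by positivity), Real.log_pow,
    Real.log_mul (by norm_num) hq0.ne'] at hlog
  -- the numerical inequality `4 * (5 / 4) ^ 8 ≤ 2 ^ 5 ≤ q ^ 5`
  have hnum : Real.log 4 + 8 * Real.log (5 / 4) ≤ 5 * Real.log q := by
    have : Real.log (4 * (5 / 4) ^ 8) ≤ Real.log (q ^ 5) :=
      Real.log_le_log (by norm_num) (le_trans (by norm_num) (pow_le_pow_left₀ (by norm_num) hq2 5))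
    rw [Real.log_mul (by norm_num) (by norm_num), Real.log_pow, Real.log_pow] at this
    exact_mod_cast this
  have hn : (0 : ℝ) ≤ n := n.cast_nonneg
  nlinarith [mul_le_mul_of_nonneg_left hnum hn]

theorem sum_sq_dist_ge {r : ℝ} (hr : 0 ≤ r) {n : ℕ} (u v : Fin n → E) :
    farCount r u v * r ^ 2 ≤ ∑ i, dist (u i) (v i) ^ 2 := by
  classical
  rw [← nsmul_eq_mul]
  refine (Finset.card_nsmul_le_sum _ (fun i => dist (u i) (v i) ^ 2) _ fun i hi => ?_).trans
    (Finset.sum_le_sum_of_subset_of_nonneg (Finset.filter_subset _ _) fun _ _ _ => by positivity)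
  exact pow_le_pow_left₀ hr (Finset.mem_filter.1 hi).2 2

end

theorem two_le_card_of_log_pos {a : ℕ} (h : 0 < Real.log a) : 2 ≤ a := by
  by_contra! h'
  interval_cases a <;> simp at h

/-! ### The Frobenius norm -/

theorem Matrix.frobenius_norm_sq {m n : ℕ} (A : Matrix (Fin m) (Fin n) ℝ) :
    ‖A‖ ^ 2 = ∑ i, ∑ j, A i j ^ 2 := by
  rw [Matrix.frobenius_norm_def, ← Real.sqrt_eq_rpow, Real.sq_sqrt (by positivity)]
  simp

theorem Matrix.frobenius_norm_sq_eq_trace {m n : ℕ} (A : Matrix (Fin m) (Fin n) ℝ) :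
    ‖A‖ ^ 2 = (Aᵀ * A).trace := by
  rw [Matrix.frobenius_norm_sq, Finset.sum_comm]
  simp [Matrix.trace, Matrix.mul_apply, sq]

/-! ### Separated unit vectors and orthogonal matrices -/

/-- A large separated set of unit vectors, namely the normalised sign vectors of a binary code. -/
theorem exists_separated_unit_vectors {d : ℕ} (hd : 1 ≤ d) :
    ∃ S : Finset (EuclideanSpace ℝ (Fin d)), (∀ u ∈ S, ‖u‖ = 1) ∧
      (∀ u ∈ S, ∀ v ∈ S, u ≠ v → 1 / 3 ≤ dist u v) ∧ 2 ≤ S.card ∧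
      (d : ℝ) / 4 * Real.log 2 ≤ Real.log S.card := by
  classical
  have hd0 : (0 : ℝ) < d := by exact_mod_cast hd
  -- the signs are at distance `2`, so a code at radius `1` has squared distance at least `d / 8`
  let sgn : Bool → ℝ := fun b => if b then 1 else -1
  obtain ⟨C, hC, hlog⟩ := exists_adaptive_code (fun _ _ => sgn) (ε := 2) (by norm_num)
    (by
      rintro - - (_ | _) (_ | _) hab <;> simp [sgn, Real.dist_eq] at hab ⊢ <;> norm_num)
    (by simp) d
  simp only [adaptiveSeq_const, Fintype.card_bool, Nat.cast_ofNat] at hC hlog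
  let f : (Fin d → Bool) → EuclideanSpace ℝ (Fin d) := fun x =>
    WithLp.toLp 2 fun i => (√d)⁻¹ * sgn (x i)
  have hdist : ∀ x ∈ C, ∀ y ∈ C, x ≠ y → 1 / 3 ≤ dist (f x) (f y) := by
    intro x hx y hy hxy
    have h1 := hC x hx y hy hxy
    have h2 := sum_sq_dist_ge (r := 2 / 2) (by norm_num) (fun i => sgn (x i)) (fun i => sgn (y i))
    have h3 : dist (f x) (f y) ^ 2 = (d : ℝ)⁻¹ * ∑ i, dist (sgn (x i)) (sgn (y i)) ^ 2 := by
      rw [EuclideanSpace.dist_eq, Real.sq_sqrt (by positivity), Finset.mul_sum]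
      refine Finset.sum_congr rfl fun i _ => ?_
      simp only [f, Real.dist_eq, sq_abs]
      rw [← mul_sub, mul_pow, inv_pow, Real.sq_sqrt hd0.le]
    have h4 : 1 / 8 ≤ dist (f x) (f y) ^ 2 := by
      rw [h3, ← div_eq_inv_mul, le_div_iff₀ hd0]
      linarith
    nlinarith [dist_nonneg (x := f x) (y := f y)]
  have hinj : Set.InjOn f C := by
    intro x hx y hy hxy
    by_contra hne
    have := hdist x hx y hy hne
    rw [hxy, dist_self] at this
    norm_num at this
  have hpos : 0 < Real.log 2 := Real.log_pos (by norm_num)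
  refine ⟨C.image f, ?_, ?_, ?_, ?_⟩
  · simp only [Finset.mem_image]
    rintro _ ⟨x, -, rfl⟩
    have hentry : ∀ i, ‖(√d)⁻¹ * sgn (x i)‖ ^ 2 = (d : ℝ)⁻¹ := by
      intro i
      cases hxi : x i <;> simp [sgn, Real.sq_sqrt hd0.le]
    rw [EuclideanSpace.norm_eq, Finset.sum_congr rfl fun i _ => hentry i]
    simp [hd0.ne']
  · simp only [Finset.mem_image]
    rintro _ ⟨x, hx, rfl⟩ _ ⟨y, hy, rfl⟩ hxy
    exact hdist x hx y hy fun h => hxy (h ▸ rfl)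
  · rw [Finset.card_image_of_injOn hinj]
    exact two_le_card_of_log_pos (lt_of_lt_of_le (by positivity) hlog)
  · rwa [Finset.card_image_of_injOn hinj]

/-- A copy of `d`-dimensional space orthogonal to `n` given vectors. The isometry also exists when
the vectors leave no room for it, so that the choice of the next column is a total function. -/
theorem exists_isometry_orthogonal_to {d k : ℕ} (hdk : d ≤ k) (n : ℕ)
    (u : Fin n → EuclideanSpace ℝ (Fin k)) :
    ∃ L : EuclideanSpace ℝ (Fin d) →ₗᵢ[ℝ] EuclideanSpace ℝ (Fin k),
      n + d ≤ k → ∀ i w, inner ℝ (L w) (u i) = 0 := by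
  have key : ∀ W : Submodule ℝ (EuclideanSpace ℝ (Fin k)), d ≤ Module.finrank ℝ W →
      ∃ L : EuclideanSpace ℝ (Fin d) →ₗᵢ[ℝ] EuclideanSpace ℝ (Fin k), ∀ w, L w ∈ W := by
    intro W hW
    let b := stdOrthonormalBasis ℝ W
    have hb : Orthonormal ℝ fun i : Fin d =>
        ((b (Fin.castLE hW i) : W) : EuclideanSpace ℝ (Fin k)) :=
      (b.orthonormal.comp _ (Fin.castLE_injective hW)).comp_linearIsometry W.subtypeₗᵢ
    let e := (EuclideanSpace.basisFun (Fin d) ℝ)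
    refine ⟨(e.toBasis.constr ℝ fun i : Fin d =>
      ((b (Fin.castLE hW i) : W) : EuclideanSpace ℝ (Fin k))).isometryOfOrthonormal
        (v := e.toBasis) ?_ ?_, fun w => ?_⟩
    · simp
    · convert hb using 2 with i
      exact (e.toBasis.constr_basis ℝ _ i)
    · change e.toBasis.constr ℝ _ w ∈ W
      rw [Module.Basis.constr_apply_fintype]
      exact W.sum_mem fun i _ => W.smul_mem _ (Subtype.coe_prop _)
  by_cases h : n + d ≤ k
  · obtain ⟨L, hL⟩ := key (Submodule.span ℝ (Set.range u))ᗮ (by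
      have h1 := (Submodule.span ℝ (Set.range u)).finrank_add_finrank_orthogonal
      have h2 := finrank_range_le_card (R := ℝ) u
      rw [Set.finrank] at h2
      simp at h1 h2
      omega)
    exact ⟨L, fun _ i w => Submodule.inner_left_of_mem_orthogonal
      (Submodule.subset_span (Set.mem_range_self i)) (hL w)⟩
  · obtain ⟨L, -⟩ := key ⊤ (by simpa using hdk)
    exact ⟨L, fun h' => absurd h' h⟩

theorem orthonormal_cons {E : Type*} [NormedAddCommGroup E] [InnerProductSpace ℝ E] {n : ℕ}
    {a : E} {u : Fin n → E} (ha : ‖a‖ = 1) (hu : Orthonormal ℝ u) (h : ∀ i, inner ℝ a (u i) = 0) :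
    Orthonormal ℝ (Fin.cons a u : Fin (n + 1) → E) := by
  refine ⟨fun i => ?_, fun i j hij => ?_⟩
  · refine Fin.cases ?_ (fun i => ?_) i
    · simpa using ha
    · simpa using hu.1 i
  · induction i using Fin.cases <;> induction j using Fin.cases
    · exact absurd rfl hij
    · simpa using h _
    · simpa [real_inner_comm] using h _
    · simpa using hu.2 (fun h => hij (congrArg Fin.succ h))

/-- A set of `exp(c k²)` orthogonal matrices with distances of order `√k`. The first half of the
columns is an adaptive code; the others are an arbitrary completion to an orthonormal basis. -/
theorem exists_separated_orthogonal_matrices {k : ℕ} (hk : 1 ≤ k) :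
    ∃ S : Finset (Matrix (Fin k) (Fin k) ℝ), (∀ O ∈ S, Oᵀ * O = 1) ∧
      (∀ O ∈ S, ∀ O' ∈ S, O ≠ O' → √k / 24 ≤ ‖O - O'‖) ∧ 2 ≤ S.card ∧
      (k : ℝ) ^ 2 / 64 * Real.log 2 ≤ Real.log S.card := by
  classical
  -- `d` is the dimension in which each new column is chosen, `p` the number of such columns
  set d := k / 2 + 1 with hd
  set p := k - k / 2 with hp
  obtain ⟨S, hunit, hsep, hcard, hlogS⟩ := exists_separated_unit_vectors (d := d) (by omega)
  choose L hL using exists_isometry_orthogonal_to (d := d) (k := k) (by omega)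
  let next : ∀ n, (Fin n → EuclideanSpace ℝ (Fin k)) → S → EuclideanSpace ℝ (Fin k) :=
    fun n u a => L n u a
  obtain ⟨C, hC, hlogC⟩ := exists_adaptive_code next (ε := 1 / 3) (by norm_num)
    (fun n u a b hab => by
      simpa only [next, LinearIsometry.dist_map] using
        hsep a a.2 b b.2 fun h => hab (Subtype.ext h)) (by simpa using hcard) p
  have horth : ∀ n, n ≤ p → ∀ x : Fin n → S, Orthonormal ℝ (adaptiveSeq next n x) := by
    intro n
    induction n with
    | zero => exact fun _ x => ⟨fun i => i.elim0, fun i => i.elim0⟩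
    | succ n ih =>
      intro hn x
      refine orthonormal_cons ?_ (ih (by omega) _) fun i => hL n _ (by omega) i _
      simpa only [next, LinearIsometry.norm_map] using hunit _ (x 0).2
  have hpk : p ≤ k := by omega
  have hbasis : ∀ x : Fin p → S, ∃ b : OrthonormalBasis (Fin k) ℝ (EuclideanSpace ℝ (Fin k)),
      ∀ i, b (Fin.castLE hpk i) = adaptiveSeq next p x i := by
    intro x
    let v : Fin k → EuclideanSpace ℝ (Fin k) := fun j =>
      if h : (j : ℕ) < p then adaptiveSeq next p x ⟨j, h⟩ else 0
    obtain ⟨b, hb⟩ := Orthonormal.exists_orthonormalBasis_extension_of_card_eq (𝕜 := ℝ)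
      (E := EuclideanSpace ℝ (Fin k)) (ι := Fin k) (by simp) (v := v) (s := {j | (j : ℕ) < p}) (by
        let g : {j : Fin k | (j : ℕ) < p} → Fin p := fun j => ⟨(j : Fin k), j.2⟩
        have hg : Function.Injective g := fun a b hab =>
          Subtype.ext (Fin.ext (Fin.mk.inj hab))
        have hv : Set.domRestrict {j : Fin k | (j : ℕ) < p} v = adaptiveSeq next p x ∘ g := by
          funext j
          have hj : ((j : Fin k) : ℕ) < p := j.2
          simp [v, g, hj]
        rw [hv]
        exact (horth p le_rfl x).comp g hg)
    refine ⟨b, fun i => ?_⟩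
    rw [hb _ (by simp)]
    simp [v]
  choose b hb using hbasis
  let f : (Fin p → S) → Matrix (Fin k) (Fin k) ℝ := fun x => Matrix.of fun i j => b x j i
  have hp0 : (k : ℝ) / 2 ≤ p := by
    have : k ≤ 2 * p := by omega
    have : (k : ℝ) ≤ 2 * p := by exact_mod_cast this
    linarith
  have hd0 : (k : ℝ) / 2 ≤ d := by
    have : k ≤ 2 * d := by omega
    have : (k : ℝ) ≤ 2 * d := by exact_mod_cast this
    linarith
  have hk0 : (1 : ℝ) ≤ k := by exact_mod_cast hk
  have hdist : ∀ x ∈ C, ∀ y ∈ C, x ≠ y → √k / 24 ≤ ‖f x - f y‖ := by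
    intro x hx y hy hxy
    have h1 := hC x hx y hy hxy
    have h2 := sum_sq_dist_ge (r := 1 / 3 / 2) (by norm_num) (adaptiveSeq next p x)
      (adaptiveSeq next p y)
    have h3 : ∑ i, dist (adaptiveSeq next p x i) (adaptiveSeq next p y i) ^ 2 ≤
        ‖f x - f y‖ ^ 2 := by
      have hcol : ‖f x - f y‖ ^ 2 = ∑ j, dist (b x j) (b y j) ^ 2 := by
        rw [Matrix.frobenius_norm_sq, Finset.sum_comm]
        refine Finset.sum_congr rfl fun j _ => ?_
        rw [EuclideanSpace.dist_eq, Real.sq_sqrt (by positivity)]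
        simp [f, Real.dist_eq]
      rw [hcol]
      simp only [← hb]
      refine (Finset.sum_map Finset.univ (Fin.castLEEmb hpk)
        (fun j => dist (b x j) (b y j) ^ 2)).symm.le.trans ?_
      exact Finset.sum_le_sum_of_subset_of_nonneg (Finset.subset_univ _)
        fun _ _ _ => by positivity
    have h4 : (k : ℝ) / 576 ≤ ‖f x - f y‖ ^ 2 := by linarith
    refine abs_le_of_sq_le_sq' ?_ (norm_nonneg _) |>.2
    rw [div_pow, Real.sq_sqrt (by positivity)]
    linarith
  have hinj : Set.InjOn f C := by
    intro x hx y hy hxy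
    by_contra hne
    have := hdist x hx y hy hne
    rw [hxy, sub_self, norm_zero] at this
    have : 0 < √(k : ℝ) / 24 := by positivity
    linarith
  have hpos : 0 < Real.log 2 := Real.log_pos (by norm_num)
  have hlog : (k : ℝ) ^ 2 / 64 * Real.log 2 ≤ Real.log C.card := by
    refine le_trans ?_ hlogC
    rw [Fintype.card_coe]
    calc (k : ℝ) ^ 2 / 64 * Real.log 2 = (k / 2 / 4) * ((k / 2 / 4) * Real.log 2) := by ring
      _ ≤ (p / 4) * ((d / 4) * Real.log 2) := by gcongr
      _ ≤ _ := by gcongr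
  refine ⟨C.image f, ?_, ?_, ?_, ?_⟩
  · simp only [Finset.mem_image]
    rintro _ ⟨x, -, rfl⟩
    ext i j
    have := orthonormal_iff_ite.1 (b x).orthonormal i j
    rw [Matrix.one_apply, ← this, PiLp.inner_apply]
    simp [f, Matrix.mul_apply, mul_comm]
  · simp only [Finset.mem_image]
    rintro _ ⟨x, hx, rfl⟩ _ ⟨y, hy, rfl⟩ hxy
    exact hdist x hx y hy fun h => hxy (h ▸ rfl)
  · rw [Finset.card_image_of_injOn hinj]
    exact two_le_card_of_log_pos (lt_of_lt_of_le (by positivity) hlog)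
  · rwa [Finset.card_image_of_injOn hinj]

/-! ### Distances between projections -/

theorem frobenius_norm_sq_projection_sub {m k : ℕ} {V V' : Matrix (Fin m) (Fin k) ℝ}
    (hV : Vᵀ * V = 1) (hV' : V'ᵀ * V' = 1) :
    ‖V * Vᵀ - V' * V'ᵀ‖ ^ 2 = 2 * k - 2 * ‖Vᵀ * V'‖ ^ 2 := by
  have hself : ∀ W : Matrix (Fin m) (Fin k) ℝ, Wᵀ * W = 1 →
      (W * Wᵀ * (W * Wᵀ)).trace = k := by
    intro W hW
    rw [Matrix.mul_assoc, ← Matrix.mul_assoc Wᵀ, hW, Matrix.one_mul, Matrix.trace_mul_comm, hW]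
    simp
  have hcross : (V * Vᵀ * (V' * V'ᵀ)).trace = ‖Vᵀ * V'‖ ^ 2 := by
    rw [Matrix.frobenius_norm_sq_eq_trace, Matrix.trace_mul_comm, Matrix.mul_assoc,
      Matrix.trace_mul_comm]
    simp [Matrix.mul_assoc]
  have hcross' : (V' * V'ᵀ * (V * Vᵀ)).trace = ‖Vᵀ * V'‖ ^ 2 := by
    rw [Matrix.trace_mul_comm, hcross]
  rw [Matrix.frobenius_norm_sq_eq_trace]
  simp only [Matrix.transpose_sub, Matrix.transpose_mul, Matrix.transpose_transpose,
    Matrix.sub_mul, Matrix.mul_sub, Matrix.trace_sub, hself V hV, hself V' hV', hcross, hcross']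
  ring

theorem frobenius_norm_of_orthogonal {k : ℕ} {O : Matrix (Fin k) (Fin k) ℝ} (hO : Oᵀ * O = 1) :
    ‖O‖ = √k := by
  rw [← Real.sqrt_sq (norm_nonneg O), Matrix.frobenius_norm_sq_eq_trace, hO]
  simp

/-- Convexity gain: a sum of `a` identity matrices and `b` orthogonal matrices `Oᵢᵀ Oᵢ'` is shorter
than `(a + b) √k`, since `2 tr (Oᵢᵀ Oᵢ') = 2k - ‖Oᵢ - Oᵢ'‖²` for the cross terms. -/
theorem mul_sum_sq_le_of_orthogonal {a b k : ℕ} (O O' : Fin b → Matrix (Fin k) (Fin k) ℝ)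
    (hO : ∀ i, (O i)ᵀ * O i = 1) (hO' : ∀ i, (O' i)ᵀ * O' i = 1) :
    ‖(a : ℝ) • (1 : Matrix (Fin k) (Fin k) ℝ) + ∑ i, (O i)ᵀ * O' i‖ ^ 2 ≤
      ((a : ℝ) + b) ^ 2 * k - a * ∑ i, ‖O i - O' i‖ ^ 2 := by
  set N := ∑ i, (O i)ᵀ * O' i with hN
  have hnorm : ‖N‖ ≤ b * √k := by
    refine (norm_sum_le _ _).trans ?_
    have : ∀ i, ‖(O i)ᵀ * O' i‖ = √k := fun i => frobenius_norm_of_orthogonal (by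
      rw [Matrix.transpose_mul, Matrix.transpose_transpose, Matrix.mul_assoc,
        ← Matrix.mul_assoc (O i), mul_eq_one_comm.1 (hO i), Matrix.one_mul, hO' i])
    simp [this]
  have hnorm2 : ‖N‖ ^ 2 ≤ (b : ℝ) ^ 2 * k := by
    have := pow_le_pow_left₀ (norm_nonneg _) hnorm 2
    rwa [mul_pow, Real.sq_sqrt (Nat.cast_nonneg k)] at this
  have hdist : ∑ i, ‖O i - O' i‖ ^ 2 = 2 * (b * k) - 2 * N.trace := by
    have : ∀ i, ‖O i - O' i‖ ^ 2 = 2 * k - 2 * ((O i)ᵀ * O' i).trace := by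
      intro i
      have hsymm : ((O' i)ᵀ * O i).trace = ((O i)ᵀ * O' i).trace := by
        rw [← Matrix.trace_transpose]
        simp
      rw [Matrix.frobenius_norm_sq_eq_trace]
      simp only [Matrix.transpose_sub, Matrix.sub_mul, Matrix.mul_sub, Matrix.trace_sub, hO, hO',
        hsymm, Matrix.trace_one, Fintype.card_fin]
      ring
    simp only [this, Finset.sum_sub_distrib, ← Finset.mul_sum, hN, Matrix.trace_sum]
    simp
  have hexp : ‖(a : ℝ) • (1 : Matrix (Fin k) (Fin k) ℝ) + N‖ ^ 2 =
      (a : ℝ) ^ 2 * k + 2 * a * N.trace + ‖N‖ ^ 2 := by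
    rw [Matrix.frobenius_norm_sq_eq_trace, Matrix.frobenius_norm_sq_eq_trace]
    simp only [Matrix.transpose_add, Matrix.transpose_smul, Matrix.transpose_one, Matrix.add_mul,
      Matrix.mul_add, Matrix.smul_mul, Matrix.mul_smul, Matrix.one_mul, Matrix.mul_one,
      Matrix.trace_add, Matrix.trace_smul, Matrix.trace_transpose, Matrix.trace_one,
      Fintype.card_fin, smul_eq_mul]
    ring
  rw [hexp, hdist]
  nlinarith

/-! ### Stacking orthogonal blocks -/

/-- The matrix that stacks `O b` and `-O b` for all `b`, scaled by `(2 * card τ)^(-1/2)`. The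
embedding `e` says which row of the result holds a given row of a given signed block; rows outside
its range are zero. -/
noncomputable def blockFrame {τ : Type*} [Fintype τ] {m k : ℕ} (e : τ × Bool × Fin k ↪ Fin m)
    (O : τ → Matrix (Fin k) (Fin k) ℝ) : Matrix (Fin m) (Fin k) ℝ :=
  Matrix.of fun r j => Function.extend e
    (fun p => (√(2 * Fintype.card τ))⁻¹ * ((if p.2.1 then 1 else -1) * O p.1 p.2.2 j)) 0 r

section
variable {τ : Type*} [Fintype τ] {m k : ℕ} (e : τ × Bool × Fin k ↪ Fin m)
  (O O' : τ → Matrix (Fin k) (Fin k) ℝ)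

theorem blockFrame_apply (p : τ × Bool × Fin k) (j : Fin k) :
    blockFrame e O (e p) j =
      (√(2 * Fintype.card τ))⁻¹ * ((if p.2.1 then 1 else -1) * O p.1 p.2.2 j) := by
  simp [blockFrame, e.injective.extend_apply]

theorem blockFrame_apply_of_notMem {r : Fin m} (hr : r ∉ Set.range e) (j : Fin k) :
    blockFrame e O r j = 0 := by
  simp only [blockFrame, Matrix.of_apply]
  rw [Function.extend_apply' _ _ _ hr]
  rfl

theorem sum_blockFrame (j : Fin k) : ∑ r, blockFrame e O r j = 0 := by
  rw [← Fintype.sum_of_injective e e.injective _ _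
    (fun r hr => blockFrame_apply_of_notMem e O hr j) fun p => (blockFrame_apply e O p j).symm]
  simp [Fintype.sum_prod_type]

theorem blockFrame_transpose_mul :
    (blockFrame e O)ᵀ * blockFrame e O' = (Fintype.card τ : ℝ)⁻¹ • ∑ b, (O b)ᵀ * O' b := by
  ext i j
  rw [Matrix.mul_apply, ← Fintype.sum_of_injective e e.injective
    (fun p => (2 * Fintype.card τ : ℝ)⁻¹ * (O p.1 p.2.2 i * O' p.1 p.2.2 j)) _
    (fun r hr => by simp [blockFrame_apply_of_notMem e O hr]) fun p => ?_]
  · simp only [← Finset.mul_sum, Fintype.sum_prod_type, Fintype.sum_bool, Matrix.smul_apply,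
      Matrix.sum_apply, Matrix.mul_apply, Matrix.transpose_apply, smul_eq_mul, ← two_mul]
    rw [mul_inv]
    ring
  · rw [Matrix.transpose_apply, blockFrame_apply, blockFrame_apply]
    have hsq : (√(2 * Fintype.card τ))⁻¹ * (√(2 * Fintype.card τ))⁻¹ =
        (2 * Fintype.card τ : ℝ)⁻¹ := by
      rw [← mul_inv, Real.mul_self_sqrt (by positivity)]
    rw [← hsq]
    split_ifs <;> ring

variable {O}

theorem blockFrame_mem_centeredStiefel [Nonempty τ] (hO : ∀ b, (O b)ᵀ * O b = 1) :
    blockFrame e O ∈ centeredStiefel m k := by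
  refine ⟨?_, sum_blockFrame e O⟩
  have : (Fintype.card τ : ℝ) ≠ 0 := by exact_mod_cast Fintype.card_ne_zero
  rw [blockFrame_transpose_mul]
  simp only [hO, Finset.sum_const, Finset.card_univ, ← Nat.cast_smul_eq_nsmul ℝ, smul_smul]
  rw [inv_mul_cancel₀ this, one_smul]

theorem sum_sq_blockFrame_le (hO : ∀ b, (O b)ᵀ * O b = 1) (r : Fin m) :
    ∑ j, blockFrame e O r j ^ 2 ≤ (2 * Fintype.card τ : ℝ)⁻¹ := by
  by_cases hr : r ∈ Set.range e
  · obtain ⟨p, rfl⟩ := hr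
    have hrow : ∑ j, O p.1 p.2.2 j ^ 2 = 1 := by
      have := congrArg (fun M : Matrix (Fin k) (Fin k) ℝ => M p.2.2 p.2.2)
        (mul_eq_one_comm.1 (hO p.1))
      simpa [Matrix.mul_apply, sq] using this
    have : ∀ j, blockFrame e O (e p) j ^ 2 = (2 * Fintype.card τ : ℝ)⁻¹ * O p.1 p.2.2 j ^ 2 := by
      intro j
      rw [blockFrame_apply, mul_pow, inv_pow, Real.sq_sqrt (by positivity)]
      split_ifs <;> ring
    simp only [this, ← Finset.mul_sum, hrow, mul_one, le_refl]
  · simp only [blockFrame_apply_of_notMem e O hr]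
    simp

theorem abs_blockFrame_mul_transpose_le (hO : ∀ b, (O b)ᵀ * O b = 1) (r s : Fin m) :
    |(blockFrame e O * (blockFrame e O)ᵀ) r s| ≤ (2 * Fintype.card τ : ℝ)⁻¹ := by
  have hr := sum_sq_blockFrame_le e hO r
  have hs := sum_sq_blockFrame_le e hO s
  rw [Matrix.mul_apply]
  refine (Finset.abs_sum_le_sum_abs _ _).trans ?_
  have : ∑ j, |blockFrame e O r j * (blockFrame e O)ᵀ j s| ≤
      ∑ j, (blockFrame e O r j ^ 2 + blockFrame e O s j ^ 2) / 2 := by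
    refine Finset.sum_le_sum fun j _ => ?_
    rw [Matrix.transpose_apply, abs_mul]
    nlinarith [sq_nonneg (|blockFrame e O r j| - |blockFrame e O s j|),
      sq_abs (blockFrame e O r j), sq_abs (blockFrame e O s j)]
  rw [← Finset.sum_div, Finset.sum_add_distrib] at this
  linarith

end

/-- The `a` blocks frozen to the identity make the projection depend on the blocks `O i` themselves,
not only on the `O i` up to a common rotation. -/
theorem frobenius_norm_sq_blockFrame_ge {a b m k : ℕ} (hab : 0 < a + b)
    (e : (Fin a ⊕ Fin b) × Bool × Fin k ↪ Fin m) (O O' : Fin b → Matrix (Fin k) (Fin k) ℝ)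
    (hO : ∀ i, (O i)ᵀ * O i = 1) (hO' : ∀ i, (O' i)ᵀ * O' i = 1) :
    2 * a / ((a : ℝ) + b) ^ 2 * ∑ i, ‖O i - O' i‖ ^ 2 ≤
      ‖blockFrame e (Sum.elim 1 O) * (blockFrame e (Sum.elim 1 O))ᵀ -
        blockFrame e (Sum.elim 1 O') * (blockFrame e (Sum.elim 1 O'))ᵀ‖ ^ 2 := by
  have : Nonempty (Fin a ⊕ Fin b) := Fintype.card_pos_iff.1 (by simpa using hab)
  have hpos : (0 : ℝ) < (a : ℝ) + b := by exact_mod_cast hab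
  have hext : ∀ Q : Fin b → Matrix (Fin k) (Fin k) ℝ, (∀ i, (Q i)ᵀ * Q i = 1) →
      (blockFrame e (Sum.elim 1 Q))ᵀ * blockFrame e (Sum.elim 1 Q) = 1 := fun Q hQ =>
    (blockFrame_mem_centeredStiefel e (by rintro (i | i) <;> simp [hQ])).1
  have hsmul : ∀ (c : ℝ) (M : Matrix (Fin k) (Fin k) ℝ), ‖c • M‖ ^ 2 = c ^ 2 * ‖M‖ ^ 2 := by
    intro c M
    simp only [Matrix.frobenius_norm_sq, Matrix.smul_apply, smul_eq_mul, mul_pow, Finset.mul_sum]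
  have hsum : ∑ i, (Sum.elim (1 : Fin a → Matrix (Fin k) (Fin k) ℝ) O i)ᵀ *
      Sum.elim (1 : Fin a → Matrix (Fin k) (Fin k) ℝ) O' i =
      (a : ℝ) • (1 : Matrix (Fin k) (Fin k) ℝ) + ∑ i, (O i)ᵀ * O' i := by
    simp [Nat.cast_smul_eq_nsmul]
  have hmain := mul_sum_sq_le_of_orthogonal (a := a) O O' hO hO'
  rw [frobenius_norm_sq_projection_sub (hext O hO) (hext O' hO'), blockFrame_transpose_mul, hsum,
    hsmul, Fintype.card_sum, Fintype.card_fin, Fintype.card_fin, Nat.cast_add]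
  set R := ‖(a : ℝ) • (1 : Matrix (Fin k) (Fin k) ℝ) + ∑ i, (O i)ᵀ * O' i‖ ^ 2
  have hR : (((a : ℝ) + b)⁻¹ ^ 2 * R) * ((a : ℝ) + b) ^ 2 = R := by
    field_simp
  rw [div_mul_eq_mul_div, div_le_iff₀ (by positivity)]
  linarith

theorem mainTheorem2 :
    ∃ c₁ c₂ : ℝ, 0 < c₁ ∧ 0 < c₂ ∧
      ∀ m k : ℕ, 1 ≤ k → 4 * k ≤ m →
        ∃ 𝒱 : Finset (Matrix (Fin m) (Fin k) ℝ),
          (∀ V ∈ 𝒱, V ∈ centeredStiefel m k) ∧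
          (∀ V ∈ 𝒱, ∀ V' ∈ 𝒱, V ≠ V' → c₁ * (k : ℝ) ≤ ‖V * Vᵀ - V' * V'ᵀ‖ ^ 2) ∧
          c₂ * ((m : ℝ) * (k : ℝ)) ≤ Real.log (𝒱.card : ℝ) ∧
          (∀ V ∈ 𝒱, ∀ i j : Fin m, |(V * Vᵀ) i j| ≤ 4 * (k : ℝ) / (m : ℝ)) := by
  classical
  have hlog2 : 0 < Real.log 2 := Real.log_pos (by norm_num)
  refine ⟨1 / 55296, Real.log 2 / 3072, by norm_num, by positivity, fun m k hk hmk => ?_⟩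
  have hk0 : (0 : ℝ) < k := by exact_mod_cast hk
  have hm0 : (0 : ℝ) < m := by exact_mod_cast (by omega : 0 < m)
  -- `t` blocks of height `2 * k`, of which `b` are free and `a ≥ 1` are the identity
  set t := m / (2 * k) with ht
  have ht2 : 2 ≤ t := (Nat.le_div_iff_mul_le (by omega)).2 (by omega)
  have htm : t * (2 * k) ≤ m := Nat.div_mul_le_self m (2 * k)
  have hmt : m ≤ 4 * k * t := by
    have h1 : m < 2 * k * (t + 1) := Nat.lt_mul_div_succ m (by omega)
    nlinarith
  set b := t / 2 with hb
  set a := t - b with ha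
  have hab : a + b = t := by omega
  obtain ⟨S, hS, hsep, hcard, hlogS⟩ := exists_separated_orthogonal_matrices hk
  have hsqrt : 0 < √(k : ℝ) := Real.sqrt_pos.2 hk0
  obtain ⟨C, hC, hlogC⟩ := exists_adaptive_code
    (fun _ _ => ((↑) : S → Matrix (Fin k) (Fin k) ℝ)) (ε := √k / 24) (by positivity)
    (fun _ _ O O' h => by
      simpa only [dist_eq_norm] using hsep O O.2 O' O'.2 fun h' => h (Subtype.ext h'))
    (by simpa using hcard) b
  simp only [adaptiveSeq_const] at hC
  obtain ⟨e⟩ : Nonempty ((Fin a ⊕ Fin b) × Bool × Fin k ↪ Fin m) :=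
    Function.Embedding.nonempty_of_card_le (by simp [hab]; exact htm)
  let f : (Fin b → S) → Matrix (Fin m) (Fin k) ℝ := fun x =>
    blockFrame e (Sum.elim 1 fun i => (x i : Matrix (Fin k) (Fin k) ℝ))
  have horth : ∀ x : Fin b → S, ∀ i, (Sum.elim (1 : Fin a → Matrix (Fin k) (Fin k) ℝ)
      (fun i => (x i : Matrix (Fin k) (Fin k) ℝ)) i)ᵀ * Sum.elim (1 : Fin a → _)
      (fun i => (x i : Matrix (Fin k) (Fin k) ℝ)) i = 1 := by
    rintro x (i | i)
    · simp
    · exact hS _ (x i).2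
  have : Nonempty (Fin a ⊕ Fin b) := Fintype.card_pos_iff.1 (by simp; omega)
  have htR : (a : ℝ) + b = t := by exact_mod_cast hab
  have ht0 : (0 : ℝ) < t := by exact_mod_cast (by omega : 0 < t)
  have hbt : (t : ℝ) / 3 ≤ b := by
    have : (t : ℝ) ≤ 3 * b := by exact_mod_cast (by omega : t ≤ 3 * b)
    linarith
  have hat : (t : ℝ) / 2 ≤ a := by
    have : (t : ℝ) ≤ 2 * a := by exact_mod_cast (by omega : t ≤ 2 * a)
    linarith
  have hdist : ∀ x ∈ C, ∀ y ∈ C, x ≠ y →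
      1 / 55296 * (k : ℝ) ≤ ‖f x * (f x)ᵀ - f y * (f y)ᵀ‖ ^ 2 := by
    intro x hx y hy hxy
    have h1 := hC x hx y hy hxy
    have h2 := sum_sq_dist_ge (r := √(k : ℝ) / 24 / 2) (by positivity)
      (fun i => (x i : Matrix (Fin k) (Fin k) ℝ)) (fun i => (y i : Matrix (Fin k) (Fin k) ℝ))
    simp only [div_pow, Real.sq_sqrt hk0.le, dist_eq_norm] at h2
    refine le_trans ?_ (frobenius_norm_sq_blockFrame_ge (by omega) e _ _
      (fun i => hS _ (x i).2) fun i => hS _ (y i).2)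
    have h3 : (b : ℝ) / 8 * (k / 24 ^ 2 / 2 ^ 2) ≤ _ :=
      (mul_le_mul_of_nonneg_right h1 (by positivity)).trans h2
    refine le_trans ?_ (mul_le_mul_of_nonneg_left h3 (by positivity))
    rw [htR, div_mul_eq_mul_div (2 * (a : ℝ)), le_div_iff₀ (by positivity)]
    have h4 : (t : ℝ) / 2 * (t / 3) ≤ a * b := by gcongr
    nlinarith [mul_le_mul_of_nonneg_left h4 hk0.le]
  have hinj : Set.InjOn f C := by
    intro x hx y hy hxy
    by_contra hne
    have h := hdist x hx y hy hne
    rw [hxy, sub_self, norm_zero] at h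
    linarith
  refine ⟨C.image f, ?_, ?_, ?_, ?_⟩
  · simp only [Finset.mem_image]
    rintro _ ⟨x, -, rfl⟩
    exact blockFrame_mem_centeredStiefel e (horth x)
  · simp only [Finset.mem_image]
    rintro _ ⟨x, hx, rfl⟩ _ ⟨y, hy, rfl⟩ hxy
    exact hdist x hx y hy fun h => hxy (h ▸ rfl)
  · rw [Finset.card_image_of_injOn hinj]
    refine le_trans ?_ hlogC
    rw [Fintype.card_coe]
    have hmt' : (m : ℝ) / (4 * k) ≤ t := by
      rw [div_le_iff₀' (by positivity)]
      exact_mod_cast hmt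
    calc Real.log 2 / 3072 * ((m : ℝ) * k)
        = m / (4 * k) / 3 / 4 * ((k : ℝ) ^ 2 / 64 * Real.log 2) := by field_simp; norm_num
      _ ≤ t / 3 / 4 * ((k : ℝ) ^ 2 / 64 * Real.log 2) := by gcongr
      _ ≤ b / 4 * Real.log S.card := by gcongr
  · simp only [Finset.mem_image]
    rintro _ ⟨x, -, rfl⟩ i j
    refine (abs_blockFrame_mul_transpose_le e (horth x) i j).trans ?_
    rw [Fintype.card_sum, Fintype.card_fin, Fintype.card_fin, hab, inv_le_iff_one_le_mul₀
      (by positivity), div_mul_eq_mul_div, le_div_iff₀ hm0]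
    have : (m : ℝ) ≤ 4 * k * t := by exact_mod_cast hmt
    nlinarith
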